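/- Let $\mathcal{C}$ be a triangulated category with suspension functor $\Sigma$, and write $\operatorname{Ext}^1_{\mathcal{C}}(X,Y)=\operatorname{Hom}_{\mathcal{C}}(X,\Sigma Y)$. For full subcategories $\mathcal{X},\mathcal{Y}$ of $\mathcal{C}$, let $\mathcal{X}*\mathcal{Y}$ be the full subcategory of those objects $Z$ for which there is a distinguished triangle $X\to Z\to Y\to\Sigma X$ with $X\in\mathcal{X}$, $Y\in\mathcal{Y}$. A cotorsion pair on $\mathcal{C}$ is a pair $(\mathcal{U},\mathcal{V})$ of full additive subcategories of $\mathcal{C}$, closed under isomorphisms and direct summands, such that $\operatorname{Ext}^1_{\mathcal{C}}(\mathcal{U},\mathcal{V})=0$ and $\mathcal{C}=\mathcal{U}*\Sigma\mathcal{V}$. A twin cotorsion pair on $\mathcal{C}$ is a pair $((\mathcal{S},\mathcal{T}),(\mathcal{U},\mathcal{V}))$ of cotorsion pairs on $\mathcal{C}$ such that $\operatorname{Ext}^1_{\mathcal{C}}(\mathcal{S},\mathcal{V})=0$. Given a twin cotorsion pair, put $$\mathcal{W}=\mathcal{T}\cap\mathcal{U},\qquad \mathcal{C}^-=\Sigma^{-1}\mathcal{S}*\mathcal{W},\qquad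 \mathcal{C}^+=\mathcal{W}*\Sigma\mathcal{V},\qquad \mathcal{H}=\mathcal{C}^-\cap\mathcal{C}^+ .$$ Its heart is the additive quotient $\overline{\mathcal{H}}=\mathcal{H}/[\mathcal{W}]$, where $[\mathcal{W}]$ is the ideal of the morphisms that factor through an object of $\mathcal{W}$. **Theorem.** Let $((\mathcal{S},\mathcal{T}),(\mathcal{U},\mathcal{V}))$ be a twin cotorsion pair on a triangulated category $\mathcal{C}$. If $\mathcal{H}=\mathcal{C}^-$ or $\mathcal{H}=\mathcal{C}^+$, then the heart $\overline{\mathcal{H}}=\mathcal{H}/[\mathcal{W}]$ is quasi-abelian; that is, $\overline{\mathcal{H}}$ is an additive category in which every morphism has a kernel and a cokernel, the class of cokernels is stable under pullback, and the class of kernels is stable under pushout. -/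

import Mathlib

open CategoryTheory CategoryTheory.Limits CategoryTheory.Pretriangulated

universe v u

namespace QuasiAbelianHeart

/-! ### Preabelian and quasi-abelian categories -/

section QuasiAbelian

variable (A : Type u) [Category.{v} A] [Preadditive A]

/-- A preabelian category is an additive category (a preadditive category with finite biproducts,
in particular with a zero object) in which every morphism has a kernel and a cokernel. -/
structure IsPreabelian : Prop where
  hasFiniteBiproducts : HasFiniteBiproducts A
  hasKernels : HasKernels A
  hasCokernels : HasCokernels A

/-- The class of all kernels: morphisms which are a kernel of some morphism. -/
def kernels : MorphismProperty A := fun _ _ f => Nonempty (NormalMono f)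

/-- The class of all cokernels: morphisms which are a cokernel of some morphism. -/
def cokernels : MorphismProperty A := fun _ _ f => Nonempty (NormalEpi f)

/-- A preabelian category is left quasi-abelian if cokernels are stable under pullback. -/
structure IsLeftQuasiAbelian : Prop extends IsPreabelian A where
  cokernels_stable : (cokernels A).IsStableUnderBaseChange

/-- A preabelian category is right quasi-abelian if kernels are stable under pushout. -/
structure IsRightQuasiAbelian : Prop extends IsPreabelian A where
  kernels_stable : (kernels A).IsStableUnderCobaseChange

/-- A preabelian category is quasi-abelian if it is left and right quasi-abelian. -/
structure IsQuasiAbelian : Prop extends IsLeftQuasiAbelian A, IsRightQuasiAbelian A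

end QuasiAbelian

/-! ### Twin cotorsion pairs on a triangulated category -/

section Triangulated

variable {C : Type u} [Category.{v} C] [HasZeroObject C] [HasShift C ℤ] [Preadditive C]
  [∀ n : ℤ, (shiftFunctor C n).Additive] [Pretriangulated C]

/-- The full subcategory of `C` given by `P` is additive and is closed under isomorphisms and
direct summands. (In a triangulated category, the retracts of an object are exactly its direct
summands.) -/
structure IsAdditiveSubcategory (P : ObjectProperty C) : Prop where
  containsZero : P.ContainsZero
  biprod : ∀ {X Y : C}, P X → P Y → P (X ⊞ Y)
  isClosedUnderIsomorphisms : P.IsClosedUnderIsomorphisms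
  isStableUnderRetracts : P.IsStableUnderRetracts

/-- `Ext¹(U, V) = 0`, where `Ext¹(X, Y) = Hom(X, ΣY)`. -/
def ExtOneVanishes (U V : ObjectProperty C) : Prop :=
  ∀ ⦃X Y : C⦄, U X → V Y → ∀ f : X ⟶ Y⟦(1 : ℤ)⟧, f = 0

/-- The subcategory `Σ P`, closed under isomorphisms. -/
abbrev susp (P : ObjectProperty C) : ObjectProperty C := P.map (shiftFunctor C (1 : ℤ))

/-- The subcategory `Σ⁻¹ P`, closed under isomorphisms. -/
abbrev desusp (P : ObjectProperty C) : ObjectProperty C := P.map (shiftFunctor C (-1 : ℤ))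

/-- `U * V`: the objects `X` for which there is a distinguished triangle `A ⟶ X ⟶ B ⟶ ΣA` with
`A` in `U` and `B` in `V`. -/
abbrev star (U V : ObjectProperty C) : ObjectProperty C := U.extensionProduct V

variable (C) in
/-- A cotorsion pair `(U, V)` on `C`: `Ext¹(U, V) = 0` and `C = U * ΣV`. -/
structure CotorsionPair where
  left : ObjectProperty C
  right : ObjectProperty C
  left_additive : IsAdditiveSubcategory left
  right_additive : IsAdditiveSubcategory right
  ext_vanishes : ExtOneVanishes left right
  star_eq_top : star left (susp right) = ⊤

variable (C) in
/-- A twin cotorsion pair `((S, T), (U, V))` on `C`: two cotorsion pairs `(S, T)` and `(U, V)` with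
`Ext¹(S, V) = 0`. -/
structure TwinCotorsionPair where
  fst : CotorsionPair C
  snd : CotorsionPair C
  ext_vanishes : ExtOneVanishes fst.left snd.right

namespace TwinCotorsionPair

variable (p : TwinCotorsionPair C)

/-- The subcategory `S` of `((S, T), (U, V))`. -/
abbrev S : ObjectProperty C := p.fst.left

/-- The subcategory `T` of `((S, T), (U, V))`. -/
abbrev T : ObjectProperty C := p.fst.right

/-- The subcategory `U` of `((S, T), (U, V))`. -/
abbrev U : ObjectProperty C := p.snd.left

/-- The subcategory `V` of `((S, T), (U, V))`. -/
abbrev V : ObjectProperty C := p.snd.right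

/-- `W = T ∩ U`. -/
def W : ObjectProperty C := p.T ⊓ p.U

/-- `C⁻ = Σ⁻¹S * W`. -/
def Cminus : ObjectProperty C := star (desusp p.S) p.W

/-- `C⁺ = W * ΣV`. -/
def Cplus : ObjectProperty C := star p.W (susp p.V)

/-- `H = C⁻ ∩ C⁺`. -/
def H : ObjectProperty C := p.Cminus ⊓ p.Cplus

end TwinCotorsionPair

/-! ### The heart -/

/-- The morphism `f` belongs to `[P](X, Y)`, that is, `f` factors through an object of `P`. -/
def FactorsThroughObj (P : ObjectProperty C) {X Y : C} (f : X ⟶ Y) : Prop :=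
  ∃ (Z : C) (_ : P Z) (a : X ⟶ Z) (b : Z ⟶ Y), a ≫ b = f

namespace TwinCotorsionPair

variable (p : TwinCotorsionPair C)

/-- Two parallel morphisms of `H` are identified in the heart when their difference belongs to the
ideal `[W]`. -/
def heartRel : HomRel p.H.FullSubcategory :=
  fun _ _ f g => FactorsThroughObj p.W (f.hom - g.hom)

lemma W_biprod {X Y : C} (hX : p.W X) (hY : p.W Y) : p.W (X ⊞ Y) :=
  ⟨p.fst.right_additive.biprod hX.1 hY.1, p.snd.left_additive.biprod hX.2 hY.2⟩

lemma factors_zero (X Y : C) : FactorsThroughObj p.W (0 : X ⟶ Y) := by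
  obtain ⟨Z, hZ, h⟩ := p.fst.right_additive.containsZero.exists_zero
  obtain ⟨Z', hZ', h'⟩ := p.snd.left_additive.containsZero.exists_zero
  have := p.snd.left_additive.isClosedUnderIsomorphisms
  exact ⟨Z, ⟨h, p.U.prop_of_iso (hZ'.iso hZ) h'⟩, 0, 0, by simp⟩

lemma factors_add {X Y : C} {f g : X ⟶ Y} (hf : FactorsThroughObj p.W f)
    (hg : FactorsThroughObj p.W g) : FactorsThroughObj p.W (f + g) := by
  obtain ⟨Z, hZ, a, b, rfl⟩ := hf
  obtain ⟨Z', hZ', a', b', rfl⟩ := hg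
  exact ⟨Z ⊞ Z', p.W_biprod hZ hZ', biprod.lift a a', biprod.desc b b', by simp⟩

lemma factors_neg {X Y : C} {f : X ⟶ Y} (hf : FactorsThroughObj p.W f) :
    FactorsThroughObj p.W (-f) := by
  obtain ⟨Z, hZ, a, b, rfl⟩ := hf
  exact ⟨Z, hZ, -a, b, by simp⟩

instance heartRel_congruence : Congruence p.heartRel where
  equivalence :=
    { refl := fun f => by
        change FactorsThroughObj p.W (f.hom - f.hom)
        rw [sub_self]
        exact p.factors_zero _ _
      symm := fun {f g} h => by
        change FactorsThroughObj p.W (g.hom - f.hom)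
        rw [← neg_sub]
        exact p.factors_neg h
      trans := fun {f g k} h h' => by
        change FactorsThroughObj p.W (f.hom - k.hom)
        rw [← sub_add_sub_cancel f.hom g.hom k.hom]
        exact p.factors_add h h' }
  comp_left := by
    rintro X Y Z f g g' ⟨A, hA, a, b, h⟩
    refine ⟨A, hA, f.hom ≫ a, b, ?_⟩
    simp [h]
  comp_right := by
    rintro X Y Z f f' g ⟨A, hA, a, b, h⟩
    refine ⟨A, hA, a, b ≫ g.hom, ?_⟩
    rw [← Category.assoc, h]
    simp

lemma heartRel_add ⦃X Y : p.H.FullSubcategory⦄ (f₁ f₂ g₁ g₂ : X ⟶ Y)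
    (hf : p.heartRel f₁ f₂) (hg : p.heartRel g₁ g₂) : p.heartRel (f₁ + g₁) (f₂ + g₂) := by
  change FactorsThroughObj p.W ((f₁.hom + g₁.hom) - (f₂.hom + g₂.hom))
  rw [add_sub_add_comm]
  exact p.factors_add hf hg

/-- The heart `H / [W]` of the twin cotorsion pair: the additive quotient of the full subcategory
`H` by the ideal of the morphisms that factor through an object of `W`. -/
abbrev Heart : Type u := CategoryTheory.Quotient p.heartRel

/-- The addition of morphisms in the heart is induced by that of `C`. -/
instance heartPreadditive : Preadditive p.Heart :=
  CategoryTheory.Quotient.preadditive p.heartRel p.heartRel_add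

end TwinCotorsionPair

end Triangulated

end QuasiAbelianHeart

/-! Let `C⁻ ⊆ C⁺`; the other case is dual, since on `Cᵒᵖ` the pair `((V, U), (T, S))` exchanges `C⁻`
and `C⁺` and keeps `W`. Three vanishing facts drive the proof: there are no nonzero morphisms `Σ⁻¹S
⟶ W`, `W ⟶ ΣV` or `S ⟶ ΣV`. Because of them a morphism with fibre in `Σ⁻¹S` is epi modulo `[W]` when
tested against `C⁺` (`factors_of_comp_left`), and one with cone in `ΣV` is mono modulo `[W]` when
tested against `C⁻` (`factors_of_comp_right`).

Cokernels: for `f : A ⟶ B` and a triangle `Z ⟶ A ⟶ D` with `Z` in `Σ⁻¹S` and `D` in `W`, the cone of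
`Z ⟶ A ⟶ B` is the cokernel of `f` modulo `[W]`. A homotopy pullback of `B ⟶ M` again has fibre `Z`,
so it is again a cokernel.

Kernels: for a triangle `D ⟶ B ⟶ E` with `D` in `W` and `E` in `ΣV`, take the fibre of `A ⟶ B ⟶ E`
and then its `C⁻`-approximation (`exists_Cminus_approx`). By the octahedral axiom the resulting
morphism to `A` still has cone in `ΣV`, so its homotopy pushouts, approximated from `C⁻`, are
kernels too.

These homotopy squares need not become pullbacks or pushouts in the heart. It is enough that they
cover: the pullback of a cokernel is then the second factor of a cokernel, hence itself a cokernel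
(`CokernelsCover.of_comp`), and dually. -/

namespace QuasiAbelianHeart

/-! ### Exactness and completion for triangles with explicit morphisms -/

section Triangles

variable {C : Type u} [Category.{v} C] [HasZeroObject C] [HasShift C ℤ] [Preadditive C]
  [∀ n : ℤ, (shiftFunctor C n).Additive] [Pretriangulated C]

lemma exists_desc_of_distTriang {X Y Z A : C} {f : X ⟶ Y} {g : Y ⟶ Z} {h : Z ⟶ X⟦(1 : ℤ)⟧}
    (hT : Triangle.mk f g h ∈ distTriang C) (a : Y ⟶ A) (ha : f ≫ a = 0) :
    ∃ b : Z ⟶ A, g ≫ b = a := by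
  obtain ⟨b, hb⟩ := Triangle.yoneda_exact₂ _ hT a ha
  exact ⟨b, hb.symm⟩

lemma exists_lift_of_distTriang {X Y Z A : C} {f : X ⟶ Y} {g : Y ⟶ Z} {h : Z ⟶ X⟦(1 : ℤ)⟧}
    (hT : Triangle.mk f g h ∈ distTriang C) (a : A ⟶ Y) (ha : a ≫ g = 0) :
    ∃ b : A ⟶ X, b ≫ f = a := by
  obtain ⟨b, hb⟩ := Triangle.coyoneda_exact₂ _ hT a ha
  exact ⟨b, hb.symm⟩

lemma comp_eq_zero_of_distTriang {X Y Z : C} {f : X ⟶ Y} {g : Y ⟶ Z} {h : Z ⟶ X⟦(1 : ℤ)⟧}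
    (hT : Triangle.mk f g h ∈ distTriang C) : f ≫ g = 0 :=
  comp_distTriang_mor_zero₁₂ _ hT

/-- A morphism killed by the first morphism of a triangle comes from the third object. -/
lemma exists_coextension_of_distTriang {X Y Z A : C} {f : X ⟶ Y} {g : Y ⟶ Z}
    {h : Z ⟶ X⟦(1 : ℤ)⟧} (hT : Triangle.mk f g h ∈ distTriang C) (a : A ⟶ X)
    (ha : a ≫ f = 0) : ∃ b : A⟦(1 : ℤ)⟧ ⟶ Z, b ≫ h = a⟦(1 : ℤ)⟧' := by
  obtain ⟨b, hb⟩ := Triangle.coyoneda_exact₁ _ hT (a⟦(1 : ℤ)⟧')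
    (((shiftFunctor C (1 : ℤ)).map_comp a f).symm.trans
      ((congrArg _ ha).trans (Functor.map_zero _ _ _)))
  exact ⟨b, hb.symm⟩

lemma exists_desc_shift_of_distTriang {X Y Z A : C} {f : X ⟶ Y} {g : Y ⟶ Z}
    {h : Z ⟶ X⟦(1 : ℤ)⟧} (hT : Triangle.mk f g h ∈ distTriang C) (a : Z ⟶ A) (ha : g ≫ a = 0) :
    ∃ b : X⟦(1 : ℤ)⟧ ⟶ A, h ≫ b = a :=
  exists_desc_of_distTriang (rot_of_distTriang _ hT) a ha

lemma exists_map₂_of_distTriang {X Y Z X' Y' Z' : C} {f : X ⟶ Y} {g : Y ⟶ Z}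
    {h : Z ⟶ X⟦(1 : ℤ)⟧} {f' : X' ⟶ Y'} {g' : Y' ⟶ Z'} {h' : Z' ⟶ X'⟦(1 : ℤ)⟧}
    (hT : Triangle.mk f g h ∈ distTriang C) (hT' : Triangle.mk f' g' h' ∈ distTriang C)
    (a : X ⟶ X') (c : Z ⟶ Z') (hac : h ≫ a⟦(1 : ℤ)⟧' = c ≫ h') :
    ∃ b : Y ⟶ Y', f ≫ b = a ≫ f' ∧ g ≫ c = b ≫ g' :=
  complete_distinguished_triangle_morphism₂ _ _ hT hT' a c hac

lemma exists_map₃_of_distTriang {X Y Z X' Y' Z' : C} {f : X ⟶ Y} {g : Y ⟶ Z}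
    {h : Z ⟶ X⟦(1 : ℤ)⟧} {f' : X' ⟶ Y'} {g' : Y' ⟶ Z'} {h' : Z' ⟶ X'⟦(1 : ℤ)⟧}
    (hT : Triangle.mk f g h ∈ distTriang C) (hT' : Triangle.mk f' g' h' ∈ distTriang C)
    (a : X ⟶ X') (b : Y ⟶ Y') (hab : f ≫ b = a ≫ f') :
    ∃ c : Z ⟶ Z', g ≫ c = b ≫ g' := by
  obtain ⟨c, hc, -⟩ := complete_distinguished_triangle_morphism _ _ hT hT' a b hab
  exact ⟨c, hc⟩

end Triangles

/-! ### Membership in `ΣP` and `Σ⁻¹P` -/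

section Shift

variable {C : Type u} [Category.{v} C] [HasShift C ℤ]

lemma susp_iff {P : ObjectProperty C} [P.IsClosedUnderIsomorphisms] (Y : C) :
    susp P Y ↔ P (Y⟦(-1 : ℤ)⟧) := by
  refine (ObjectProperty.prop_map_iff _ _ _).trans ?_
  constructor
  · rintro ⟨X, hX, ⟨e⟩⟩
    exact P.prop_of_iso ((shiftShiftNeg X (1 : ℤ)).symm ≪≫ (shiftFunctor C (-1 : ℤ)).mapIso e) hX
  · intro h
    exact ⟨_, h, ⟨shiftNegShift Y (1 : ℤ)⟩⟩

lemma desusp_iff {P : ObjectProperty C} [P.IsClosedUnderIsomorphisms] (Y : C) :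
    desusp P Y ↔ P (Y⟦(1 : ℤ)⟧) := by
  refine (ObjectProperty.prop_map_iff _ _ _).trans ?_
  constructor
  · rintro ⟨X, hX, ⟨e⟩⟩
    exact P.prop_of_iso ((shiftNegShift X (1 : ℤ)).symm ≪≫ (shiftFunctor C (1 : ℤ)).mapIso e) hX
  · intro h
    exact ⟨_, h, ⟨shiftShiftNeg Y (1 : ℤ)⟩⟩

end Shift

section Factors

variable {C : Type u} [Category.{v} C] {P : ObjectProperty C}

lemma FactorsThroughObj.comp_right {X Y Z : C} {f : X ⟶ Y} (hf : FactorsThroughObj P f)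
    (g : Y ⟶ Z) : FactorsThroughObj P (f ≫ g) := by
  obtain ⟨A, hA, a, b, rfl⟩ := hf
  exact ⟨A, hA, a, b ≫ g, by simp⟩

end Factors

/-! ### Orthogonality in cotorsion pairs and the subcategory `C⁻` -/

section Triangulated

variable {C : Type u} [Category.{v} C] [HasZeroObject C] [HasShift C ℤ] [Preadditive C]
  [∀ n : ℤ, (shiftFunctor C n).Additive] [Pretriangulated C]

namespace CotorsionPair

variable (q : CotorsionPair C)

instance : q.left.IsClosedUnderIsomorphisms := q.left_additive.isClosedUnderIsomorphisms
instance : q.right.IsClosedUnderIsomorphisms := q.right_additive.isClosedUnderIsomorphisms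
instance : q.left.IsStableUnderRetracts := q.left_additive.isStableUnderRetracts
instance : q.right.IsStableUnderRetracts := q.right_additive.isStableUnderRetracts

lemma hom_desusp_left_eq_zero {Z T : C} (hZ : desusp q.left Z) (hT : q.right T) (f : Z ⟶ T) :
    f = 0 := by
  apply (shiftFunctor C (1 : ℤ)).map_injective
  rw [Functor.map_zero]
  exact q.ext_vanishes ((desusp_iff Z).1 hZ) hT _

lemma hom_susp_right_eq_zero {U Y : C} (hU : q.left U) (hY : susp q.right Y) (f : U ⟶ Y) :
    f = 0 := by
  obtain ⟨V, hV, ⟨e⟩⟩ := (ObjectProperty.prop_map_iff _ _ _).1 hY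
  rw [← cancel_mono e.inv, zero_comp]
  exact q.ext_vanishes hU hV _

lemma exists_left_approx (X : C) : ∃ (A Y : C) (a : A ⟶ X) (b : X ⟶ Y) (c : Y ⟶ A⟦(1 : ℤ)⟧),
    Triangle.mk a b c ∈ distTriang C ∧ q.left A ∧ susp q.right Y := by
  have : star q.left (susp q.right) X := by rw [q.star_eq_top]; trivial
  exact this

lemma exists_right_approx (X : C) : ∃ (Z B : C) (a : Z ⟶ X) (b : X ⟶ B) (c : B ⟶ Z⟦(1 : ℤ)⟧),
    Triangle.mk a b c ∈ distTriang C ∧ desusp q.left Z ∧ q.right B := by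
  obtain ⟨A, Y, a, b, c, hT, hA, hY⟩ := q.exists_left_approx (X⟦(1 : ℤ)⟧)
  have h : star (desusp q.left) q.right (X⟦(1 : ℤ)⟧⟦(-1 : ℤ)⟧) :=
    ⟨A⟦(-1 : ℤ)⟧, Y⟦(-1 : ℤ)⟧, _, _, _, Triangle.shift_distinguished _ hT (-1),
      ObjectProperty.prop_map_obj _ _ hA, (susp_iff Y).1 hY⟩
  exact (star (desusp q.left) q.right).prop_of_iso (shiftShiftNeg X (1 : ℤ)) h

/-- In the approximation triangle `A ⟶ X ⟶ Y` the second morphism vanishes, so the first splits and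
`X` is a retract of `A`. -/
lemma left_of_hom_eq_zero {X : C} (hX : ∀ ⦃Y : C⦄, susp q.right Y → ∀ f : X ⟶ Y, f = 0) :
    q.left X := by
  obtain ⟨A, Y, a, b, c, hT, hA, hY⟩ := q.exists_left_approx X
  obtain ⟨s, hs⟩ := exists_lift_of_distTriang hT (𝟙 X) (by simpa using hX hY b)
  exact q.left.prop_of_retract ⟨s, a, hs⟩ hA

lemma right_of_hom_eq_zero {X : C} (hX : ∀ ⦃Z : C⦄, desusp q.left Z → ∀ f : Z ⟶ X, f = 0) :
    q.right X := by
  obtain ⟨Z, B, a, b, c, hT, hZ, hB⟩ := q.exists_right_approx X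
  obtain ⟨s, hs⟩ := exists_desc_of_distTriang hT (𝟙 X) (by simpa using hX hZ a)
  exact q.right.prop_of_retract ⟨b, s, hs⟩ hB

lemma susp_right_of_hom_eq_zero {X : C} (hX : ∀ ⦃U : C⦄, q.left U → ∀ f : U ⟶ X, f = 0) :
    susp q.right X := by
  rw [susp_iff]
  refine q.right_of_hom_eq_zero fun Z hZ f => ?_
  apply (shiftFunctor C (1 : ℤ)).map_injective
  rw [Functor.map_zero, ← cancel_mono (shiftNegShift X (1 : ℤ)).hom, zero_comp]
  exact hX ((desusp_iff Z).1 hZ) _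

lemma susp_right_of_distTriang {X Y Z : C} {f : X ⟶ Y} {g : Y ⟶ Z} {h : Z ⟶ X⟦(1 : ℤ)⟧}
    (hT : Triangle.mk f g h ∈ distTriang C) (hX : susp q.right X) (hZ : susp q.right Z) :
    susp q.right Y :=
  q.susp_right_of_hom_eq_zero fun U hU a => by
    obtain ⟨b, rfl⟩ := exists_lift_of_distTriang hT a (q.hom_susp_right_eq_zero hU hZ _)
    rw [q.hom_susp_right_eq_zero hU hX b, zero_comp]

end CotorsionPair

namespace TwinCotorsionPair

variable (p : TwinCotorsionPair C)

lemma hom_shift_eq_zero {Z Y : C} (hZ : desusp p.S Z) (hY : susp p.V Y)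
    (f : Z⟦(1 : ℤ)⟧ ⟶ Y) : f = 0 := by
  obtain ⟨V, hV, ⟨e⟩⟩ := (ObjectProperty.prop_map_iff _ _ _).1 hY
  rw [← cancel_mono e.inv, zero_comp]
  exact p.ext_vanishes ((desusp_iff Z).1 hZ) hV _

lemma hom_desusp_S_W_eq_zero {Z A : C} (hZ : desusp p.S Z) (hA : p.W A) (f : Z ⟶ A) : f = 0 :=
  p.fst.hom_desusp_left_eq_zero hZ hA.1 f

lemma hom_W_susp_V_eq_zero {A Y : C} (hA : p.W A) (hY : susp p.V Y) (f : A ⟶ Y) : f = 0 :=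
  p.snd.hom_susp_right_eq_zero hA.2 hY f

lemma comp_eq_zero_of_factors_of_susp {X L Y : C} (hY : susp p.V Y) {f : X ⟶ L}
    (hf : FactorsThroughObj p.W f) (g : L ⟶ Y) : f ≫ g = 0 := by
  obtain ⟨A, hA, a, b, rfl⟩ := hf
  rw [Category.assoc, p.hom_W_susp_V_eq_zero hA hY (b ≫ g), comp_zero]

lemma comp_eq_zero_of_desusp_of_factors {Z B X : C} (hZ : desusp p.S Z) (f : Z ⟶ B) {g : B ⟶ X}
    (hg : FactorsThroughObj p.W g) : f ≫ g = 0 := by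
  obtain ⟨A, hA, a, b, rfl⟩ := hg
  rw [← Category.assoc, p.hom_desusp_S_W_eq_zero hZ hA (f ≫ a), zero_comp]

lemma comp_eq_zero_of_Cminus {X T Y : C} (hX : p.Cminus X) (hT : p.T T) (hY : susp p.V Y)
    (a : X ⟶ T) (b : T ⟶ Y) : a ≫ b = 0 := by
  obtain ⟨Z, A, i, j, k, hTr, hZ, hA⟩ := hX
  obtain ⟨c, rfl⟩ := exists_desc_of_distTriang hTr a (p.fst.hom_desusp_left_eq_zero hZ hT _)
  rw [Category.assoc, p.hom_W_susp_V_eq_zero hA hY (c ≫ b), comp_zero]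

/-- With `comp_eq_zero_of_Cminus` this describes `C⁻` by vanishing of composites, from which its
closure properties follow. In the triangle `Z ⟶ X ⟶ T` of `(S, T)`, a morphism from `T` to `ΣV`
vanishes on `X`, so it factors through `ΣZ` and is zero by `Ext¹(S, V) = 0`; thus `T` lies in `U`.
-/
lemma Cminus_of_comp_eq_zero {X : C} (hX : ∀ ⦃T Y : C⦄, p.T T → susp p.V Y →
    ∀ (a : X ⟶ T) (b : T ⟶ Y), a ≫ b = 0) : p.Cminus X := by
  obtain ⟨Z, T, a, b, c, hTr, hZ, hT⟩ := p.fst.exists_right_approx X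
  refine ⟨Z, T, a, b, c, hTr, hZ, hT, p.snd.left_of_hom_eq_zero fun Y hY f => ?_⟩
  obtain ⟨g, rfl⟩ := exists_desc_shift_of_distTriang hTr f (hX hT hY b f)
  have : g = 0 := p.hom_shift_eq_zero hZ hY g
  rw [this, comp_zero]

lemma Cminus_of_desusp {Z : C} (hZ : desusp p.S Z) : p.Cminus Z :=
  p.Cminus_of_comp_eq_zero fun T Y hT hY a b => by
    rw [p.fst.hom_desusp_left_eq_zero hZ hT a, zero_comp]

lemma Cminus_of_distTriang {Z X Y : C} {f : Z ⟶ X} {g : X ⟶ Y} {h : Y ⟶ Z⟦(1 : ℤ)⟧}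
    (hTr : Triangle.mk f g h ∈ distTriang C) (hZ : desusp p.S Z) (hY : p.Cminus Y) :
    p.Cminus X :=
  p.Cminus_of_comp_eq_zero fun T Y' hT hY' a b => by
    obtain ⟨c, rfl⟩ := exists_desc_of_distTriang hTr a (p.fst.hom_desusp_left_eq_zero hZ hT _)
    rw [Category.assoc, p.comp_eq_zero_of_Cminus hY hT hY', comp_zero]

lemma Cminus_of_distTriang' {Z X Y : C} {f : Z ⟶ X} {g : X ⟶ Y} {h : Y ⟶ Z⟦(1 : ℤ)⟧}
    (hTr : Triangle.mk f g h ∈ distTriang C) (hZ : desusp p.S Z) (hX : p.Cminus X) :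
    p.Cminus Y :=
  p.Cminus_of_comp_eq_zero fun T Y' hT hY' a b => by
    obtain ⟨c, hc⟩ := exists_desc_shift_of_distTriang hTr (a ≫ b)
      (by simpa using p.comp_eq_zero_of_Cminus hX hT hY' (g ≫ a) b)
    have : c = 0 := p.hom_shift_eq_zero hZ hY' c
    rw [← hc, this, comp_zero]

/-- Every object `L` has a right `C⁻`-approximation `K ⟶ L` whose cone `Y` lies in `ΣV`, and the
morphism `L ⟶ Y` vanishes on `C⁻`. -/
lemma exists_Cminus_approx [IsTriangulated C] (L : C) :
    ∃ (K Y : C) (k : K ⟶ L) (g : L ⟶ Y) (h : Y ⟶ K⟦(1 : ℤ)⟧),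
      Triangle.mk k g h ∈ distTriang C ∧ p.Cminus K ∧ susp p.V Y ∧
        ∀ ⦃X : C⦄, p.Cminus X → ∀ x : X ⟶ L, x ≫ g = 0 := by
  obtain ⟨Z, T, a, b, c, hT₁, hZ, hT⟩ := p.fst.exists_right_approx L
  obtain ⟨A, Y, i, j, l, hT₂, hA, hY⟩ := p.snd.exists_left_approx T
  obtain ⟨K, k, h, hT₃⟩ := distinguished_cocone_triangle₁ (b ≫ j)
  -- A morphism from `Σ⁻¹S` to `A` dies in `T`, so its suspension factors through a morphism from
  -- `S` to `Y` in `ΣV`, which is zero. Hence `A` lies in `W`, and the octahedron on `L ⟶ T ⟶ Y`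
  -- yields a triangle `Z ⟶ K ⟶ A`.
  have hAT : p.T A := p.fst.right_of_hom_eq_zero fun Z' hZ' f => by
    obtain ⟨g, hg⟩ := exists_coextension_of_distTriang hT₂ f
      (p.fst.hom_desusp_left_eq_zero hZ' hT _)
    apply (shiftFunctor C (1 : ℤ)).map_injective
    rw [← hg, p.hom_shift_eq_zero hZ' hY g, zero_comp, Functor.map_zero]
  exact ⟨K, Y, k, b ≫ j, h, hT₃,
    ⟨Z, A, _, _, _, (Triangulated.someOctahedron' rfl hT₁ hT₂ hT₃).mem, hZ, hAT, hA⟩, hY,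
    fun X hX x => by
      rw [← Category.assoc]
      exact p.comp_eq_zero_of_Cminus hX hT hY _ _⟩

end TwinCotorsionPair

end Triangulated

/-! ### Kernels and cokernels modulo `[W]` -/

section Modulo

variable {C : Type u} [Category.{v} C] [Preadditive C] (H W : ObjectProperty C)

/-- The morphism `c` becomes a cokernel of `f` in the quotient of `H` by the ideal `[W]`. -/
structure IsCokernelModulo {A B M : C} (f : A ⟶ B) (c : B ⟶ M) : Prop where
  comp : FactorsThroughObj W (f ≫ c)
  desc : ∀ ⦃Y : C⦄, H Y → ∀ g : B ⟶ Y, FactorsThroughObj W (f ≫ g) →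
    ∃ h : M ⟶ Y, FactorsThroughObj W (c ≫ h - g)
  uniq : ∀ ⦃Y : C⦄, H Y → ∀ h : M ⟶ Y, FactorsThroughObj W (c ≫ h) → FactorsThroughObj W h

/-- The morphism `k` becomes a kernel of `f` in the quotient of `H` by the ideal `[W]`. -/
structure IsKernelModulo {K A B : C} (f : A ⟶ B) (k : K ⟶ A) : Prop where
  comp : FactorsThroughObj W (k ≫ f)
  lift : ∀ ⦃X : C⦄, H X → ∀ x : X ⟶ A, FactorsThroughObj W (x ≫ f) →
    ∃ h : X ⟶ K, FactorsThroughObj W (h ≫ k - x)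
  uniq : ∀ ⦃X : C⦄, H X → ∀ h : X ⟶ K, FactorsThroughObj W (h ≫ k) → FactorsThroughObj W h

/-- Modulo the ideal `[W]`, every morphism `f` between objects of `H` has a cokernel `c`, and for
every morphism `y` to the target of `c` there is a commutative square whose side opposite to `c` is
again a cokernel. -/
def HasCoveringCokernels : Prop :=
  ∀ ⦃A B : C⦄, H A → H B → ∀ f : A ⟶ B, ∃ (M : C) (c : B ⟶ M), H M ∧ IsCokernelModulo H W f c ∧
    ∀ ⦃Y : C⦄, H Y → ∀ y : Y ⟶ M, ∃ (A' P : C) (f' : A' ⟶ P) (c' : P ⟶ Y) (t : P ⟶ B),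
      H A' ∧ H P ∧ IsCokernelModulo H W f' c' ∧ FactorsThroughObj W (t ≫ c - c' ≫ y)

/-- Modulo the ideal `[W]`, every morphism `f` between objects of `H` has a kernel `k`, and for
every morphism `y` from the source of `k` there is a commutative square whose side opposite to `k`
is again a kernel. -/
def HasCoveringKernels : Prop :=
  ∀ ⦃A B : C⦄, H A → H B → ∀ f : A ⟶ B, ∃ (K : C) (k : K ⟶ A), H K ∧ IsKernelModulo H W f k ∧
    ∀ ⦃Y : C⦄, H Y → ∀ y : K ⟶ Y, ∃ (B' Q : C) (f' : Q ⟶ B') (k' : Y ⟶ Q) (t : A ⟶ Q),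
      H B' ∧ H Q ∧ IsKernelModulo H W f' k' ∧ FactorsThroughObj W (k ≫ t - y ≫ k')

end Modulo

/-! ### Covering cokernels and kernels when `C⁻ ⊆ C⁺` -/

section Triangulated

variable {C : Type u} [Category.{v} C] [HasZeroObject C] [HasShift C ℤ] [Preadditive C]
  [∀ n : ℤ, (shiftFunctor C n).Additive] [Pretriangulated C]

namespace TwinCotorsionPair

variable (p : TwinCotorsionPair C)

lemma factors_of_factors_sub {X Y : C} {f g : X ⟶ Y} (h : FactorsThroughObj p.W (f - g))
    (hg : FactorsThroughObj p.W g) : FactorsThroughObj p.W f := by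
  simpa using p.factors_add h hg

/-- The factorization of `c ≫ m` extends along `c`, since `Z ⟶ A` vanishes. What remains of `m`
factors through `ΣZ ⟶ Y`, and this lifts to the `W`-part of `Y` because `Hom(ΣZ, ΣV) = 0`. -/
lemma factors_of_comp_left {Z B M Y : C} {i : Z ⟶ B} {c : B ⟶ M} {h : M ⟶ Z⟦(1 : ℤ)⟧}
    (hTr : Triangle.mk i c h ∈ distTriang C) (hZ : desusp p.S Z) (hY : p.Cplus Y) (m : M ⟶ Y)
    (hm : FactorsThroughObj p.W (c ≫ m)) : FactorsThroughObj p.W m := by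
  obtain ⟨A, hA, a, b, hab⟩ := hm
  obtain ⟨a', rfl⟩ := exists_desc_of_distTriang hTr a (p.hom_desusp_S_W_eq_zero hZ hA _)
  obtain ⟨n, hn⟩ := exists_desc_shift_of_distTriang hTr (m - a' ≫ b) (by
    simp [← hab])
  obtain ⟨A', Y', j, k, l, hTr', hA', hY'⟩ := hY
  obtain ⟨n', rfl⟩ := exists_lift_of_distTriang hTr' n (p.hom_shift_eq_zero hZ hY' _)
  exact p.factors_of_factors_sub (g := a' ≫ b) ⟨A', hA', h ≫ n', j, by simp [← hn]⟩
    ⟨A, hA, a', b, rfl⟩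

/-- The factorization of `x ≫ k` lifts along `k`, since `A ⟶ Y` vanishes. What remains of `x` is
killed by `k`, hence vanishes on the `Σ⁻¹S`-part of `X` by `Ext¹(S, V) = 0`, and so factors through
the `W`-part. -/
lemma factors_of_comp_right {K L Y X : C} {k : K ⟶ L} {g : L ⟶ Y} {h : Y ⟶ K⟦(1 : ℤ)⟧}
    (hTr : Triangle.mk k g h ∈ distTriang C) (hY : susp p.V Y) (hX : p.Cminus X) (x : X ⟶ K)
    (hx : FactorsThroughObj p.W (x ≫ k)) : FactorsThroughObj p.W x := by
  obtain ⟨A, hA, a, b, hab⟩ := hx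
  obtain ⟨b', rfl⟩ := exists_lift_of_distTriang hTr b (p.hom_W_susp_V_eq_zero hA hY _)
  obtain ⟨e, he⟩ := exists_coextension_of_distTriang hTr (x - a ≫ b') (by
    simp [← hab])
  obtain ⟨Z, A', i, j, l, hTr', hZ, hA'⟩ := hX
  obtain ⟨n, hn⟩ := exists_desc_of_distTriang hTr' (x - a ≫ b') (by
    apply (shiftFunctor C (1 : ℤ)).map_injective
    rw [Functor.map_comp, ← he, ← Category.assoc, p.hom_shift_eq_zero hZ hY (i⟦(1 : ℤ)⟧' ≫ e),
      zero_comp, Functor.map_zero])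
  exact p.factors_of_factors_sub (g := a ≫ b') ⟨A', hA', j, n, hn⟩ ⟨A, hA, a, b', rfl⟩

variable {p}

lemma isCokernelModulo_of_distTriang {H : ObjectProperty C} (hH : H ≤ p.Cplus) {Z B M : C}
    {i : Z ⟶ B} {c : B ⟶ M} {h : M ⟶ Z⟦(1 : ℤ)⟧} (hTr : Triangle.mk i c h ∈ distTriang C)
    (hZ : desusp p.S Z) : IsCokernelModulo H p.W i c where
  comp := by
    rw [comp_eq_zero_of_distTriang hTr]
    exact p.factors_zero _ _
  desc Y _ g hg := by
    obtain ⟨A, hA, a, b, hab⟩ := hg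
    obtain ⟨m, rfl⟩ := exists_desc_of_distTriang hTr g
      (by rw [← hab, p.hom_desusp_S_W_eq_zero hZ hA a, zero_comp])
    exact ⟨m, by simpa using p.factors_zero _ _⟩
  uniq Y hY m hm := p.factors_of_comp_left hTr hZ (hH Y hY) m hm

lemma hasCoveringCokernels_Cminus (h : p.Cminus ≤ p.Cplus) :
    HasCoveringCokernels p.Cminus p.W := by
  intro A B hA hB f
  obtain ⟨Z, D, i, j, l, hTr, hZ, hD⟩ := hA
  -- The cone is taken of `i ≫ f` instead of `f`: a morphism that `f` kills only modulo `[W]` is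
  -- killed by `i ≫ f` exactly. The map `e` of cones shows that `f ≫ c` factors through `D`.
  obtain ⟨M, c, m, hTr'⟩ := distinguished_cocone_triangle (i ≫ f)
  obtain ⟨e, he⟩ := exists_map₃_of_distTriang hTr hTr' (𝟙 Z) f (by simp)
  refine ⟨M, c, p.Cminus_of_distTriang' hTr' hZ hB, ⟨⟨D, hD, j, e, he⟩, fun Y hY g hg => ?_,
    fun Y hY n hn => p.factors_of_comp_left hTr' hZ (h Y hY) n hn⟩, fun Y hY y => ?_⟩
  · obtain ⟨n, rfl⟩ := exists_desc_of_distTriang hTr' g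
      (by rw [Category.assoc]; exact p.comp_eq_zero_of_desusp_of_factors hZ i hg)
    exact ⟨n, by simpa using p.factors_zero _ _⟩
  -- `P` is the homotopy pullback of `c` along `y`, built as an extension of `Y` by the same `Z`.
  · obtain ⟨P, i', c', hTr''⟩ := distinguished_cocone_triangle₂ (y ≫ m)
    obtain ⟨t, -, ht⟩ := exists_map₂_of_distTriang hTr'' hTr' (𝟙 Z) y (by simp)
    exact ⟨Z, P, i', c', t, p.Cminus_of_desusp hZ, p.Cminus_of_distTriang hTr'' hZ hY,
      isCokernelModulo_of_distTriang h hTr'' hZ, by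
        rw [ht, sub_self]
        exact p.factors_zero _ _⟩

/-- The homotopy pushout of a kernel along `y`, after applying the coreflection onto `C⁻`. -/
lemma exists_isKernelModulo_of_distTriang [IsTriangulated C] {K A E Y : C} {k : K ⟶ A} {g : A ⟶ E}
    {h : E ⟶ K⟦(1 : ℤ)⟧} (hTr : Triangle.mk k g h ∈ distTriang C) (hE : susp p.V E)
    (hK : p.Cminus K) (hA : p.Cminus A) (hY : p.Cminus Y) (y : K ⟶ Y) :
    ∃ (B Q : C) (f : Q ⟶ B) (k' : Y ⟶ Q) (t : A ⟶ Q), p.Cminus B ∧ p.Cminus Q ∧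
      IsKernelModulo p.Cminus p.W f k' ∧ FactorsThroughObj p.W (k ≫ t - y ≫ k') := by
  obtain ⟨Q₀, j, g₀, hTr₀⟩ := distinguished_cocone_triangle₂ (h ≫ y⟦(1 : ℤ)⟧')
  obtain ⟨t₀, ht₀, -⟩ := exists_map₂_of_distTriang hTr hTr₀ y (𝟙 E) (by simp)
  -- Neither `Q₀` nor `E` need lie in `C⁻`, so `Q₀ ⟶ E` is replaced by a morphism between
  -- `C⁻`-approximations. Modulo `[W]` this is invisible to morphisms from `C⁻`.
  obtain ⟨Q, E₁, d, g₁, h₁, hTr₁, hQ, hE₁, lift₁⟩ := p.exists_Cminus_approx Q₀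
  obtain ⟨B, E₂, b, g₂, h₂, hTr₂, hB, hE₂, lift₂⟩ := p.exists_Cminus_approx E
  obtain ⟨t, rfl⟩ := exists_lift_of_distTriang hTr₁ t₀ (lift₁ hA t₀)
  obtain ⟨k', rfl⟩ := exists_lift_of_distTriang hTr₁ j (lift₁ hY j)
  obtain ⟨f, hf⟩ := exists_lift_of_distTriang hTr₂ (d ≫ g₀) (lift₂ hQ (d ≫ g₀))
  have hkf : (k' ≫ f) ≫ b = 0 := by
    rw [Category.assoc, hf, ← Category.assoc, comp_eq_zero_of_distTriang hTr₀]
  refine ⟨B, Q, f, k', t, hB, hQ, ⟨?_, fun X hX x hx => ?_, fun X hX x hx => ?_⟩, ?_⟩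
  · refine p.factors_of_comp_right hTr₂ hE₂ hY _ ?_
    rw [hkf]
    exact p.factors_zero _ _
  · obtain ⟨x', hx'⟩ := exists_lift_of_distTriang hTr₀ (x ≫ d) (by
      rw [Category.assoc, ← hf, ← Category.assoc]
      exact p.comp_eq_zero_of_factors_of_susp hE hx b)
    refine ⟨x', p.factors_of_comp_right hTr₁ hE₁ hX _ ?_⟩
    rw [Preadditive.sub_comp, Category.assoc, hx', sub_self]
    exact p.factors_zero _ _
  · refine p.factors_of_comp_right hTr₀ hE hX x ?_
    rw [← Category.assoc]
    exact hx.comp_right d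
  · refine p.factors_of_comp_right hTr₁ hE₁ hK _ ?_
    rw [Preadditive.sub_comp, Category.assoc, Category.assoc, ht₀, sub_self]
    exact p.factors_zero _ _

lemma hasCoveringKernels_Cminus [IsTriangulated C] (h : p.Cminus ≤ p.Cplus) :
    HasCoveringKernels p.Cminus p.W := by
  intro A B hA hB f
  obtain ⟨D, E, j, g, l, hTr, hD, hE⟩ := h B hB
  obtain ⟨L, i, m, hTrL⟩ := distinguished_cocone_triangle₁ (f ≫ g)
  obtain ⟨K, E', k, g', h', hTrK, hK, hE', lift⟩ := p.exists_Cminus_approx L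
  obtain ⟨E'', g'', h'', hTr''⟩ := distinguished_cocone_triangle (k ≫ i)
  -- The octahedron on `K ⟶ L ⟶ A` exhibits `E''` as an extension of `E` by `E'`, and `ΣV` is closed
  -- under extensions.
  have hE'' : susp p.V E'' := p.snd.susp_right_of_distTriang
    (Triangulated.someOctahedron rfl hTrK hTrL hTr'').mem hE' hE
  refine ⟨K, k ≫ i, hK, ⟨?_, fun X hX x hx => ?_, fun X hX x hx => ?_⟩, fun Y hY y =>
    exists_isKernelModulo_of_distTriang hTr'' hE'' hK hA hY y⟩
  · obtain ⟨a, ha⟩ := exists_lift_of_distTriang hTr ((k ≫ i) ≫ f) (by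
      rw [Category.assoc, Category.assoc, comp_eq_zero_of_distTriang hTrL, comp_zero])
    exact ⟨D, hD, a, j, ha⟩
  · obtain ⟨x₁, rfl⟩ := exists_lift_of_distTriang hTrL x (by
      rw [← Category.assoc]
      exact p.comp_eq_zero_of_factors_of_susp hE hx g)
    obtain ⟨x₂, rfl⟩ := exists_lift_of_distTriang hTrK x₁ (lift hX x₁)
    exact ⟨x₂, by simpa using p.factors_zero _ _⟩
  · exact p.factors_of_comp_right hTr'' hE'' hX x hx

end TwinCotorsionPair

end Triangulated

/-! ### Passage to the opposite category -/

section Duality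

open Opposite CategoryTheory.Pretriangulated.Opposite

section Modulo

variable {C : Type u} [Category.{v} C] {H W : ObjectProperty C}

lemma factorsThroughObj_op_iff {X Y : Cᵒᵖ} (f : X ⟶ Y) :
    FactorsThroughObj W.op f ↔ FactorsThroughObj W f.unop :=
  ⟨fun ⟨Z, hZ, a, b, h⟩ => ⟨Z.unop, hZ, b.unop, a.unop, by rw [← h, unop_comp]⟩,
    fun ⟨Z, hZ, a, b, h⟩ => ⟨op Z, hZ, b.op, a.op, by rw [← op_comp, h, Quiver.Hom.op_unop]⟩⟩

variable [Preadditive C]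

lemma IsCokernelModulo.unop {A B M : Cᵒᵖ} {f : A ⟶ B} {c : B ⟶ M}
    (h : IsCokernelModulo H.op W.op f c) : IsKernelModulo H W f.unop c.unop where
  comp := (factorsThroughObj_op_iff _).1 h.comp
  lift X hX x hx := by
    obtain ⟨y, hy⟩ := h.desc (Y := op X) hX x.op ((factorsThroughObj_op_iff _).2 hx)
    exact ⟨y.unop, (factorsThroughObj_op_iff _).1 hy⟩
  uniq X hX x hx := (factorsThroughObj_op_iff _).1
    (h.uniq (Y := op X) hX x.op ((factorsThroughObj_op_iff _).2 hx))

lemma IsKernelModulo.unop {K A B : Cᵒᵖ} {f : A ⟶ B} {k : K ⟶ A}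
    (h : IsKernelModulo H.op W.op f k) : IsCokernelModulo H W f.unop k.unop where
  comp := (factorsThroughObj_op_iff _).1 h.comp
  desc Y hY y hy := by
    obtain ⟨x, hx⟩ := h.lift (X := op Y) hY y.op ((factorsThroughObj_op_iff _).2 hy)
    exact ⟨x.unop, (factorsThroughObj_op_iff _).1 hx⟩
  uniq Y hY y hy := (factorsThroughObj_op_iff _).1
    (h.uniq (X := op Y) hY y.op ((factorsThroughObj_op_iff _).2 hy))

lemma HasCoveringCokernels.unop (h : HasCoveringCokernels H.op W.op) :
    HasCoveringKernels H W := by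
  intro A B hA hB f
  obtain ⟨M, c, hM, hc, cover⟩ := h (A := op B) (B := op A) hB hA f.op
  refine ⟨M.unop, c.unop, hM, hc.unop, fun Y hY y => ?_⟩
  obtain ⟨A', P, f', c', t, hA', hP, hc', ht⟩ := cover (Y := op Y) hY y.op
  exact ⟨A'.unop, P.unop, f'.unop, c'.unop, t.unop, hA', hP, hc'.unop,
    (factorsThroughObj_op_iff _).1 ht⟩

lemma HasCoveringKernels.unop (h : HasCoveringKernels H.op W.op) :
    HasCoveringCokernels H W := by
  intro A B hA hB f
  obtain ⟨M, c, hM, hc, cover⟩ := h (A := op B) (B := op A) hB hA f.op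
  refine ⟨M.unop, c.unop, hM, hc.unop, fun Y hY y => ?_⟩
  obtain ⟨A', P, f', c', t, hA', hP, hc', ht⟩ := cover (Y := op Y) hY y.op
  exact ⟨A'.unop, P.unop, f'.unop, c'.unop, t.unop, hA', hP, hc'.unop,
    (factorsThroughObj_op_iff _).1 ht⟩

end Modulo

section Shift

variable {C : Type u} [Category.{v} C] [HasShift C ℤ]

lemma susp_op (P : ObjectProperty C) [P.IsClosedUnderIsomorphisms] :
    (susp P).op = desusp P.op := by
  ext X
  rw [desusp_iff]
  exact susp_iff _

lemma desusp_op (P : ObjectProperty C) [P.IsClosedUnderIsomorphisms] :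
    (desusp P).op = susp P.op := by
  ext X
  rw [susp_iff]
  exact desusp_iff _

end Shift

variable {C : Type u} [Category.{v} C] [HasZeroObject C] [HasShift C ℤ] [Preadditive C]
  [∀ n : ℤ, (shiftFunctor C n).Additive] [Pretriangulated C]

lemma IsAdditiveSubcategory.op {P : ObjectProperty C} (h : IsAdditiveSubcategory P) :
    IsAdditiveSubcategory P.op := by
  have := h.containsZero
  have := h.isClosedUnderIsomorphisms
  have := h.isStableUnderRetracts
  refine ⟨inferInstance, fun {X Y} hX hY => ?_, inferInstance,
    ⟨fun r hY => P.prop_of_retract ⟨r.r.unop, r.i.unop, congrArg Quiver.Hom.unop r.retract⟩ hY⟩⟩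
  exact P.op.prop_of_iso (biprod.opIso X.unop Y.unop) (h.biprod hX hY)

lemma star_op (P Q : ObjectProperty C) : (star P Q).op = star Q.op P.op := by
  ext X
  constructor
  · rintro ⟨A, B, f, g, h, hT, hA, hB⟩
    exact ⟨op B, op A, _, _, _, op_distinguished _ hT, hB, hA⟩
  · rintro ⟨A, B, f, g, h, hT, hA, hB⟩
    exact ⟨B.unop, A.unop, _, _, _, unop_distinguished _ hT, hB, hA⟩

/-- The cotorsion pair `(V, U)` on the opposite category. -/
def CotorsionPair.op (q : CotorsionPair C) : CotorsionPair Cᵒᵖ where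
  left := q.right.op
  right := q.left.op
  left_additive := q.right_additive.op
  right_additive := q.left_additive.op
  -- The shift by `1` on `Cᵒᵖ` is the shift by `-1` on `C`, so `f.unop` goes from `Σ⁻¹U` to `V`.
  ext_vanishes X Y hX hY f := Quiver.Hom.unop_inj
    (q.hom_desusp_left_eq_zero (ObjectProperty.prop_map_obj _ _ hY) hX f.unop)
  star_eq_top := by
    rw [← desusp_op, ← star_op]
    ext X
    exact iff_of_true (q.exists_right_approx X.unop) trivial

namespace TwinCotorsionPair

/-- The twin cotorsion pair `((V, U), (T, S))` on the opposite category. -/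
def op (p : TwinCotorsionPair C) : TwinCotorsionPair Cᵒᵖ where
  fst := p.snd.op
  snd := p.fst.op
  ext_vanishes X Y hX hY f := Quiver.Hom.unop_inj (by
    apply (shiftFunctor C (1 : ℤ)).map_injective
    rw [unop_zero, Functor.map_zero]
    have hY' : desusp p.S (Y⟦(1 : ℤ)⟧).unop := ObjectProperty.prop_map_obj _ _ hY
    exact p.hom_shift_eq_zero hY' (ObjectProperty.prop_map_obj _ _ hX) _)

variable (p : TwinCotorsionPair C)

lemma W_op : p.op.W = p.W.op := by
  ext X
  exact and_comm

lemma Cminus_op : p.op.Cminus = p.Cplus.op := by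
  rw [Cminus, Cplus, star_op, W_op, susp_op]
  rfl

lemma Cplus_op : p.op.Cplus = p.Cminus.op := by
  rw [Cminus, Cplus, star_op, W_op, desusp_op]
  rfl

variable {p}

lemma hasCoveringCokernels_Cplus [IsTriangulated C] (h : p.Cplus ≤ p.Cminus) :
    HasCoveringCokernels p.Cplus p.W := by
  refine HasCoveringKernels.unop ?_
  rw [← W_op, ← Cminus_op]
  apply hasCoveringKernels_Cminus
  rw [Cminus_op, Cplus_op]
  exact ObjectProperty.op_monotone h

lemma hasCoveringKernels_Cplus (h : p.Cplus ≤ p.Cminus) :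
    HasCoveringKernels p.Cplus p.W := by
  refine HasCoveringCokernels.unop ?_
  rw [← W_op, ← Cminus_op]
  apply hasCoveringCokernels_Cminus
  rw [Cminus_op, Cplus_op]
  exact ObjectProperty.op_monotone h

end TwinCotorsionPair

end Duality

/-! ### Stability of cokernels and kernels from covering squares -/

section QuasiAbelian

variable {A : Type u} [Category.{v} A] [Preadditive A]

lemma nonempty_isColimit_cokernelCofork {X Y Z : A} {f : X ⟶ Y} {c : Y ⟶ Z} (w : f ≫ c = 0)
    [Epi c] (desc : ∀ ⦃T : A⦄ (g : Y ⟶ T), f ≫ g = 0 → ∃ h, c ≫ h = g) :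
    Nonempty (IsColimit (CokernelCofork.ofπ c w)) :=
  ⟨CokernelCofork.IsColimit.ofπ' c w fun g hg => ⟨(desc g hg).choose, (desc g hg).choose_spec⟩⟩

lemma nonempty_isLimit_kernelFork {X Y Z : A} {f : Y ⟶ Z} {k : X ⟶ Y} (w : k ≫ f = 0)
    [Mono k] (lift : ∀ ⦃T : A⦄ (g : T ⟶ Y), g ≫ f = 0 → ∃ h, h ≫ k = g) :
    Nonempty (IsLimit (KernelFork.ofι k w)) :=
  ⟨KernelFork.IsLimit.ofι' k w fun g hg => ⟨(lift g hg).choose, (lift g hg).choose_spec⟩⟩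

lemma epi_of_cokernels {X Y : A} {g : X ⟶ Y} (hg : cokernels A g) : Epi g :=
  epi_of_isColimit_cofork hg.some.isColimit

lemma mono_of_kernels {X Y : A} {g : X ⟶ Y} (hg : kernels A g) : Mono g :=
  mono_of_isLimit_fork hg.some.isLimit

lemma exists_desc_of_cokernels {X Y : A} {g : X ⟶ Y} (hg : cokernels A g) :
    ∃ (W : A) (f : W ⟶ X), f ≫ g = 0 ∧ ∀ ⦃T : A⦄ (h : X ⟶ T), f ≫ h = 0 → ∃ t, g ≫ t = h :=
  ⟨_, hg.some.g, hg.some.w, fun _ h w => by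
    let := hg.some
    exact ⟨_, (NormalEpi.desc' g h w).2⟩⟩

lemma exists_lift_of_kernels {X Y : A} {g : X ⟶ Y} (hg : kernels A g) :
    ∃ (Z : A) (f : Y ⟶ Z), g ≫ f = 0 ∧ ∀ ⦃T : A⦄ (h : T ⟶ Y), h ≫ f = 0 → ∃ t, t ≫ g = h :=
  ⟨_, hg.some.g, hg.some.w, fun _ h w => by
    let := hg.some
    exact ⟨_, (NormalMono.lift' g h w).2⟩⟩

variable (A) in
/-- For every cokernel `g` and every morphism `y` to the target of `g`, there is a commutative
square whose side opposite to `g` is again a cokernel. -/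
def CokernelsCover : Prop :=
  ∀ ⦃X Y : A⦄ (g : X ⟶ Y), cokernels A g → ∀ ⦃Y' : A⦄ (y : Y' ⟶ Y),
    ∃ (P : A) (c : P ⟶ Y') (t : P ⟶ X), cokernels A c ∧ t ≫ g = c ≫ y

variable (A) in
/-- For every kernel `g` and every morphism `y` from the source of `g`, there is a commutative
square whose side opposite to `g` is again a kernel. -/
def KernelsCocover : Prop :=
  ∀ ⦃X Y : A⦄ (g : X ⟶ Y), kernels A g → ∀ ⦃X' : A⦄ (y : X ⟶ X'),
    ∃ (Q : A) (k : X' ⟶ Q) (t : Y ⟶ Q), kernels A k ∧ g ≫ t = y ≫ k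

/-- If `r` kills the kernel of `g`, then `f ≫ r` factors as `(f ≫ g) ≫ t`. Equality of `g ≫ t` and
`r` can be tested on a cokernel `c` covering `Q`, where `c` agrees with `s ≫ f` up to a morphism
killed by `g`, hence by `r`. -/
lemma CokernelsCover.of_comp [HasKernels A] (hA : CokernelsCover A) {P Q Y : A} (f : P ⟶ Q)
    (g : Q ⟶ Y) (h : cokernels A (f ≫ g)) : cokernels A g := by
  have := epi_of_cokernels h
  have : Epi g := epi_of_epi f g
  obtain ⟨W, w, hw, desc⟩ := exists_desc_of_cokernels h
  obtain ⟨hg⟩ := nonempty_isColimit_cokernelCofork (kernel.condition g) fun T r hr => by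
    obtain ⟨t, ht⟩ := desc (f ≫ r) (by
      rw [← Category.assoc, ← kernel.lift_ι g (w ≫ f) (by simpa using hw), Category.assoc, hr,
        comp_zero])
    obtain ⟨R, c, s, hc, hs⟩ := hA (f ≫ g) h g
    have := epi_of_cokernels hc
    refine ⟨t, ?_⟩
    rw [← cancel_epi c, ← sub_eq_zero, ← Category.assoc, ← hs]
    have hd : (s ≫ f - c) ≫ g = 0 := by simpa [sub_eq_zero] using hs
    have hr' : (s ≫ f - c) ≫ r = 0 := by
      rw [← kernel.lift_ι g _ hd, Category.assoc, hr, comp_zero]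
    simpa [ht] using hr'
  exact ⟨⟨_, _, _, hg⟩⟩

lemma KernelsCocover.of_comp [HasCokernels A] (hA : KernelsCocover A) {P Q Y : A} (f : Y ⟶ Q)
    (g : Q ⟶ P) (h : kernels A (f ≫ g)) : kernels A f := by
  have := mono_of_kernels h
  have : Mono f := mono_of_mono f g
  obtain ⟨W, w, hw, lift⟩ := exists_lift_of_kernels h
  obtain ⟨hf⟩ := nonempty_isLimit_kernelFork (cokernel.condition f) fun T r hr => by
    obtain ⟨t, ht⟩ := lift (r ≫ g) (by
      rw [Category.assoc, ← cokernel.π_desc f (g ≫ w) (by simpa using hw), ← Category.assoc, hr,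
        zero_comp])
    obtain ⟨R, c, s, hc, hs⟩ := hA (f ≫ g) h f
    have := mono_of_kernels hc
    refine ⟨t, ?_⟩
    rw [← cancel_mono c, ← sub_eq_zero, Category.assoc, ← hs]
    have hd : f ≫ (g ≫ s - c) = 0 := by simpa [sub_eq_zero] using hs
    have hr' : r ≫ (g ≫ s - c) = 0 := by
      rw [← cokernel.π_desc f _ hd, ← Category.assoc, hr, zero_comp]
    rw [Preadditive.comp_sub, ← Category.assoc, ← ht] at hr'
    simpa using hr'
  exact ⟨⟨_, _, _, hf⟩⟩

lemma CokernelsCover.isStableUnderBaseChange [HasKernels A] (hA : CokernelsCover A) :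
    (cokernels A).IsStableUnderBaseChange where
  of_isPullback {X Y Y' S f g f' g'} sq hg := by
    obtain ⟨P, c, t, hc, ht⟩ := hA g hg f
    refine hA.of_comp (sq.lift t c ht) g' ?_
    rwa [sq.lift_snd]

lemma KernelsCocover.isStableUnderCobaseChange [HasCokernels A] (hA : KernelsCocover A) :
    (kernels A).IsStableUnderCobaseChange where
  of_isPushout {X X' Y Y' f g f' g'} sq hf := by
    obtain ⟨Q, k, t, hk, ht⟩ := hA f hf g
    refine hA.of_comp f' (sq.desc k t ht.symm) ?_
    rwa [sq.inl_desc]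

end QuasiAbelian

/-! ### The heart: biproducts, kernels, cokernels and covering squares -/

section Triangulated

variable {C : Type u} [Category.{v} C] [HasZeroObject C] [HasShift C ℤ] [Preadditive C]
  [∀ n : ℤ, (shiftFunctor C n).Additive] [Pretriangulated C]

namespace TwinCotorsionPair

open scoped ZeroObject

variable (p : TwinCotorsionPair C)

lemma Cminus_biprod {X Y : C} (hX : p.Cminus X) (hY : p.Cminus Y) : p.Cminus (X ⊞ Y) :=
  p.Cminus_of_comp_eq_zero fun T Y' hT hY' a b => by
    ext
    · simpa using p.comp_eq_zero_of_Cminus hX hT hY' (biprod.inl ≫ a) b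
    · simpa using p.comp_eq_zero_of_Cminus hY hT hY' (biprod.inr ≫ a) b

open CategoryTheory.Pretriangulated.Opposite in
lemma Cplus_biprod {X Y : C} (hX : p.Cplus X) (hY : p.Cplus Y) : p.Cplus (X ⊞ Y) := by
  have h := p.op.Cminus_biprod (X := .op X) (Y := .op Y) (by rwa [Cminus_op]) (by rwa [Cminus_op])
  rw [Cminus_op] at h
  have : p.Cplus.IsClosedUnderIsomorphisms := by unfold Cplus; infer_instance
  exact p.Cplus.op.prop_of_iso (biprod.opIso X Y).symm h

lemma H_biprod {X Y : C} (hX : p.H X) (hY : p.H Y) : p.H (X ⊞ Y) :=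
  ⟨p.Cminus_biprod hX.1 hY.1, p.Cplus_biprod hX.2 hY.2⟩

lemma H_zero : p.H 0 := by
  have hW : p.W 0 := ⟨p.fst.right_of_hom_eq_zero fun _ _ _ => (isZero_zero C).eq_of_tgt _ _,
    p.snd.left_of_hom_eq_zero fun _ _ _ => (isZero_zero C).eq_of_src _ _⟩
  refine ⟨p.Cminus_of_comp_eq_zero fun _ _ _ _ _ _ => (isZero_zero C).eq_of_src _ _, ?_⟩
  exact ⟨0, 0, 𝟙 0, 0, 0, contractible_distinguished 0, hW,
    p.snd.susp_right_of_hom_eq_zero fun _ _ _ => (isZero_zero C).eq_of_tgt _ _⟩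

/-- The projection functor from `H` to the heart. -/
abbrev toHeart : p.H.FullSubcategory ⥤ p.Heart := Quotient.functor p.heartRel

instance : p.toHeart.Additive := Quotient.functor_additive p.heartRel p.heartRel_add

lemma toHeart_map_eq_iff {X Y : p.H.FullSubcategory} (f g : X ⟶ Y) :
    p.toHeart.map f = p.toHeart.map g ↔ FactorsThroughObj p.W (f.hom - g.hom) :=
  Quotient.functor_map_eq_iff p.heartRel f g

lemma toHeart_map_eq_zero_iff {X Y : p.H.FullSubcategory} (f : X ⟶ Y) :
    p.toHeart.map f = 0 ↔ FactorsThroughObj p.W f.hom := by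
  rw [← p.toHeart.map_zero, toHeart_map_eq_iff]
  simp

instance : HasZeroObject p.H.FullSubcategory where
  zero := ⟨⟨0, p.H_zero⟩, by
    rw [IsZero.iff_id_eq_zero]
    ext⟩

instance : HasZeroObject p.Heart :=
  ⟨_, p.toHeart.map_isZero (isZero_zero p.H.FullSubcategory)⟩

instance : HasBinaryBiproducts p.H.FullSubcategory where
  has_binary_biproduct X Y := hasBinaryBiproduct_of_total
    { pt := ⟨X.obj ⊞ Y.obj, p.H_biprod X.property Y.property⟩
      fst := ObjectProperty.homMk biprod.fst
      snd := ObjectProperty.homMk biprod.snd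
      inl := ObjectProperty.homMk biprod.inl
      inr := ObjectProperty.homMk biprod.inr
      inl_fst := by ext; simp
      inl_snd := by ext; simp
      inr_fst := by ext; simp
      inr_snd := by ext; simp } (by ext : 1; exact biprod.total)

instance : HasBinaryBiproducts p.Heart where
  has_binary_biproduct X Y :=
    have := preservesBinaryBiproducts_of_preservesBiproducts p.toHeart
    HasBinaryBiproduct.mk ⟨p.toHeart.mapBinaryBicone (BinaryBiproduct.bicone X.as Y.as),
      isBinaryBilimitOfPreserves p.toHeart (BinaryBiproduct.isBilimit X.as Y.as)⟩

instance : HasFiniteBiproducts p.Heart :=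
  have : HasFiniteProducts p.Heart := hasFiniteProducts_of_has_binary_and_terminal
  HasFiniteBiproducts.of_hasFiniteProducts

lemma exists_isColimit_of_isCokernelModulo {X Y Z : p.H.FullSubcategory} {f : X ⟶ Y} {c : Y ⟶ Z}
    (h : IsCokernelModulo p.H p.W f.hom c.hom) : ∃ w : p.toHeart.map f ≫ p.toHeart.map c = 0,
      Nonempty (IsColimit (CokernelCofork.ofπ (p.toHeart.map c) w)) := by
  have w : p.toHeart.map f ≫ p.toHeart.map c = 0 := by
    rw [← p.toHeart.map_comp, toHeart_map_eq_zero_iff]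
    exact h.comp
  have : Epi (p.toHeart.map c) := Preadditive.epi_of_cancel_zero _ fun {T} g hg => by
    obtain ⟨g, rfl⟩ := p.toHeart.map_surjective (X := Z) (Y := T.as) g
    rw [← p.toHeart.map_comp, toHeart_map_eq_zero_iff] at hg
    rw [toHeart_map_eq_zero_iff]
    exact h.uniq T.as.property _ hg
  refine ⟨w, nonempty_isColimit_cokernelCofork w fun T g hg => ?_⟩
  obtain ⟨g, rfl⟩ := p.toHeart.map_surjective (X := Y) (Y := T.as) g
  rw [← p.toHeart.map_comp, toHeart_map_eq_zero_iff] at hg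
  obtain ⟨t, ht⟩ := h.desc T.as.property g.hom hg
  exact ⟨p.toHeart.map (Y := T.as) (ObjectProperty.homMk t), by
    rw [← p.toHeart.map_comp, toHeart_map_eq_iff]
    exact ht⟩

lemma exists_isLimit_of_isKernelModulo {X Y Z : p.H.FullSubcategory} {f : Y ⟶ Z} {k : X ⟶ Y}
    (h : IsKernelModulo p.H p.W f.hom k.hom) : ∃ w : p.toHeart.map k ≫ p.toHeart.map f = 0,
      Nonempty (IsLimit (KernelFork.ofι (p.toHeart.map k) w)) := by
  have w : p.toHeart.map k ≫ p.toHeart.map f = 0 := by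
    rw [← p.toHeart.map_comp, toHeart_map_eq_zero_iff]
    exact h.comp
  have : Mono (p.toHeart.map k) := Preadditive.mono_of_cancel_zero _ fun {T} g hg => by
    obtain ⟨g, rfl⟩ := p.toHeart.map_surjective (X := T.as) (Y := X) g
    rw [← p.toHeart.map_comp, toHeart_map_eq_zero_iff] at hg
    rw [toHeart_map_eq_zero_iff]
    exact h.uniq T.as.property _ hg
  refine ⟨w, nonempty_isLimit_kernelFork w fun T g hg => ?_⟩
  obtain ⟨g, rfl⟩ := p.toHeart.map_surjective (X := T.as) (Y := Y) g
  rw [← p.toHeart.map_comp, toHeart_map_eq_zero_iff] at hg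
  obtain ⟨t, ht⟩ := h.lift T.as.property g.hom hg
  exact ⟨p.toHeart.map (X := T.as) (ObjectProperty.homMk t), by
    rw [← p.toHeart.map_comp, toHeart_map_eq_iff]
    exact ht⟩

lemma exists_cokernel_of_hasCoveringCokernels (h : HasCoveringCokernels p.H p.W) {X Y : p.Heart}
    (f : X ⟶ Y) : ∃ (M : p.Heart) (c : Y ⟶ M) (w : f ≫ c = 0),
      Nonempty (IsColimit (CokernelCofork.ofπ c w)) ∧ ∀ ⦃Y' : p.Heart⦄ (y : Y' ⟶ M),
        ∃ (P : p.Heart) (c' : P ⟶ Y') (t : P ⟶ Y), cokernels p.Heart c' ∧ t ≫ c = c' ≫ y := by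
  obtain ⟨f, rfl⟩ := p.toHeart.map_surjective (X := X.as) (Y := Y.as) f
  obtain ⟨M, c, hM, hc, cover⟩ := h X.as.property Y.as.property f.hom
  obtain ⟨w, hw⟩ := p.exists_isColimit_of_isCokernelModulo (f := f) (Z := ⟨M, hM⟩)
    (c := ObjectProperty.homMk c) hc
  refine ⟨_, _, w, hw, fun Y' y => ?_⟩
  obtain ⟨y, rfl⟩ := p.toHeart.map_surjective (X := Y'.as) (Y := ⟨M, hM⟩) y
  obtain ⟨A', P, f', c', t, hA', hP, hc', ht⟩ := cover Y'.as.property y.hom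
  obtain ⟨w', ⟨hw'⟩⟩ := p.exists_isColimit_of_isCokernelModulo (X := ⟨A', hA'⟩) (Y := ⟨P, hP⟩)
    (Z := Y'.as) (f := ObjectProperty.homMk f') (c := ObjectProperty.homMk c') hc'
  refine ⟨_, _, p.toHeart.map (ObjectProperty.homMk t), ⟨⟨_, _, w', hw'⟩⟩, ?_⟩
  rw [← p.toHeart.map_comp, ← p.toHeart.map_comp, toHeart_map_eq_iff]
  exact ht

lemma exists_kernel_of_hasCoveringKernels (h : HasCoveringKernels p.H p.W) {X Y : p.Heart}
    (f : X ⟶ Y) : ∃ (K : p.Heart) (k : K ⟶ X) (w : k ≫ f = 0),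
      Nonempty (IsLimit (KernelFork.ofι k w)) ∧ ∀ ⦃X' : p.Heart⦄ (y : K ⟶ X'),
        ∃ (Q : p.Heart) (k' : X' ⟶ Q) (t : X ⟶ Q), kernels p.Heart k' ∧ k ≫ t = y ≫ k' := by
  obtain ⟨f, rfl⟩ := p.toHeart.map_surjective (X := X.as) (Y := Y.as) f
  obtain ⟨K, k, hK, hk, cover⟩ := h X.as.property Y.as.property f.hom
  obtain ⟨w, hw⟩ := p.exists_isLimit_of_isKernelModulo (f := f) (X := ⟨K, hK⟩)
    (k := ObjectProperty.homMk k) hk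
  refine ⟨_, _, w, hw, fun X' y => ?_⟩
  obtain ⟨y, rfl⟩ := p.toHeart.map_surjective (X := ⟨K, hK⟩) (Y := X'.as) y
  obtain ⟨B', Q, f', k', t, hB', hQ, hk', ht⟩ := cover X'.as.property y.hom
  obtain ⟨w', ⟨hw'⟩⟩ := p.exists_isLimit_of_isKernelModulo (X := X'.as) (Y := ⟨Q, hQ⟩)
    (Z := ⟨B', hB'⟩) (f := ObjectProperty.homMk f') (k := ObjectProperty.homMk k') hk'
  refine ⟨_, _, p.toHeart.map (ObjectProperty.homMk t), ⟨⟨_, _, w', hw'⟩⟩, ?_⟩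
  rw [← p.toHeart.map_comp, ← p.toHeart.map_comp, toHeart_map_eq_iff]
  exact ht

/-- The covering squares are known only for one chosen cokernel of each morphism; uniqueness of
cokernels up to isomorphism carries them to `g`. -/
lemma cokernelsCover_heart (h : HasCoveringCokernels p.H p.W) : CokernelsCover p.Heart := by
  rintro X Y g ⟨⟨A, f, w, hg⟩⟩ Y' y
  obtain ⟨M, c, wc, ⟨hc⟩, cover⟩ := p.exists_cokernel_of_hasCoveringCokernels h f
  obtain ⟨P, c', t, hc', ht⟩ := cover (y ≫ (hg.coconePointUniqueUpToIso hc).hom)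
  refine ⟨P, c', t, hc', ?_⟩
  rw [← cancel_mono (hg.coconePointUniqueUpToIso hc).hom, Category.assoc, Category.assoc, ← ht]
  congr 1
  exact hg.comp_coconePointUniqueUpToIso_hom hc WalkingParallelPair.one

lemma kernelsCocover_heart (h : HasCoveringKernels p.H p.W) : KernelsCocover p.Heart := by
  rintro X Y g ⟨⟨A, f, w, hg⟩⟩ X' y
  obtain ⟨K, k, wk, ⟨hk⟩, cover⟩ := p.exists_kernel_of_hasCoveringKernels h f
  obtain ⟨Q, k', t, hk', ht⟩ := cover ((hk.conePointUniqueUpToIso hg).hom ≫ y)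
  refine ⟨Q, k', t, hk', ?_⟩
  rw [← cancel_epi (hk.conePointUniqueUpToIso hg).hom, ← Category.assoc, ← Category.assoc, ← ht]
  congr 1
  exact hk.conePointUniqueUpToIso_hom_comp hg WalkingParallelPair.zero

lemma isQuasiAbelian_heart (hc : HasCoveringCokernels p.H p.W) (hk : HasCoveringKernels p.H p.W) :
    IsQuasiAbelian p.Heart := by
  have : HasCokernels p.Heart := ⟨fun f => by
    obtain ⟨M, c, w, ⟨h⟩, -⟩ := p.exists_cokernel_of_hasCoveringCokernels hc f
    exact ⟨⟨⟨_, h⟩⟩⟩⟩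
  have : HasKernels p.Heart := ⟨fun f => by
    obtain ⟨M, c, w, ⟨h⟩, -⟩ := p.exists_kernel_of_hasCoveringKernels hk f
    exact ⟨⟨⟨_, h⟩⟩⟩⟩
  have hA : IsPreabelian p.Heart := ⟨inferInstance, inferInstance, inferInstance⟩
  exact { hA with
    cokernels_stable := (p.cokernelsCover_heart hc).isStableUnderBaseChange
    kernels_stable := (p.kernelsCocover_heart hk).isStableUnderCobaseChange }

end TwinCotorsionPair

end Triangulated

end QuasiAbelianHeart

theorem theorem3p4 {C : Type u} [Category.{v} C] [HasZeroObject C] [HasShift C ℤ] [Preadditive C]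
    [∀ n : ℤ, (shiftFunctor C n).Additive] [Pretriangulated C] [IsTriangulated C]
    (p : QuasiAbelianHeart.TwinCotorsionPair C) (h : p.H = p.Cminus ∨ p.H = p.Cplus) :
    QuasiAbelianHeart.IsQuasiAbelian p.Heart := by
  obtain h | h := h
  · have hle : p.Cminus ≤ p.Cplus := h.symm.le.trans inf_le_right
    refine p.isQuasiAbelian_heart ?_ ?_ <;> rw [h]
    · exact QuasiAbelianHeart.TwinCotorsionPair.hasCoveringCokernels_Cminus hle
    · exact QuasiAbelianHeart.TwinCotorsionPair.hasCoveringKernels_Cminus hle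
  · have hle : p.Cplus ≤ p.Cminus := h.symm.le.trans inf_le_left
    refine p.isQuasiAbelian_heart ?_ ?_ <;> rw [h]
    · exact QuasiAbelianHeart.TwinCotorsionPair.hasCoveringCokernels_Cplus hle
    · exact QuasiAbelianHeart.TwinCotorsionPair.hasCoveringKernels_Cplus hle
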